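/- For a nonempty open interval $I=(a,b)\subseteq\mathbb{R}$, $-\infty\le a<b\le+\infty$, let $\mathrm{Lip}(I)$ be the vector space of all Lipschitz functions $f:I\to\mathbb{R}$ with the seminorm $\|f\|_{\mathrm{Lip}}=\sup_{x\ne y}\frac{|f(x)-f(y)|}{|x-y|}$. The Clarke subdifferential of $f$ at $x\in I$ is the convex hull $\partial f(x)$ of the set of all limits $\lim_n f'(x_n)$, where $x_n\to x$ and $f$ is differentiable at every $x_n\in I$. A function $f\in\mathrm{Lip}(I)$ is Clarke exhaustive if for every nonempty closed convex set $K\subseteq[-\|f\|_{\mathrm{Lip}},\|f\|_{\mathrm{Lip}}]$ there is $x\in I$ with $\partial f(x)=K$. Let $\mathcal{E}\subseteq\mathrm{Lip}(I)$ be the set of all everywhere differentiable, Clarke exhaustive Lipschitz functions on $I$. Then the following hold. 1. $\mathcal{E}$ is spaceable in $(\mathrm{Lip}(I),\|\cdot\|_{\mathrm{Lip}})$: it contains an infinite-dimensional linear subspace of $\mathrm{Lip}(I)$ that is closed for the seminorm $\|\cdot\|_{\mathrm{Lip}}$. 2. There are real numbers $a<a_n<b_n<a_{n+1}<b$ $(n\in\mathbb{N})$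 and functions $f_n\in\mathcal{E}$ with $\|f_n\|_{\mathrm{Lip}}=1$ and $\operatorname{supp} f_n\subset(a_n,b_n)$ for all $n$. 3. For every choice of $(a_n)$, $(b_n)$, $(f_n)$ as in 2, the formula $T(x)(t)=\sum_{n} x_n f_n(t)$ $(t\in I)$ defines a linear isometry $T$ from $c_0(\mathbb{N})$ (with the supremum norm) into $(\mathrm{Lip}(I),\|\cdot\|_{\mathrm{Lip}})$, and $T(x)\in\mathcal{E}$ for every $x\in c_0(\mathbb{N})$. In particular $\mathcal{E}$ contains an isometric copy of $c_0(\mathbb{N})$. -/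

import Mathlib

open scoped NNReal ZeroAtInfty Topology

/-- The quantity `‖f‖_Lip = sup_{x ≠ y} |f x - f y| / |x - y|` of a function `f : U → ℝ`
(the diagonal pairs contribute the value `0 / 0 = 0`, which does not change the supremum).
It is only used for Lipschitz `f`, where the supremum is over a bounded family. -/
noncomputable def lipSup {U : Set ℝ} (f : U → ℝ) : ℝ :=
  ⨆ p : U × U, |f p.1 - f p.2| / |(p.1 : ℝ) - (p.2 : ℝ)|

/-- The vector subspace of the Lipschitz functions in `U → ℝ`. -/
def lipSubmodule (U : Set ℝ) : Submodule ℝ (U → ℝ) where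
  carrier := {f | ∃ k : ℝ≥0, LipschitzWith k f}
  zero_mem' := ⟨0, LipschitzWith.const 0⟩
  add_mem' := by
    rintro f g ⟨k, hk⟩ ⟨l, hl⟩
    exact ⟨k + l, hk.add hl⟩
  smul_mem' := by
    rintro c f ⟨k, hk⟩
    refine ⟨‖c‖₊ * k, ?_⟩
    exact (lipschitzWith_smul c).comp hk

/-- `Lip(U)`: the vector space of all real-valued Lipschitz functions on `U`. A type of its own,
so that it carries the topology of `‖·‖_Lip` and not that of pointwise convergence. -/
def LipSpace (U : Set ℝ) : Type := lipSubmodule U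

namespace LipSpace

variable {U : Set ℝ}

instance : AddCommGroup (LipSpace U) := inferInstanceAs (AddCommGroup (lipSubmodule U))

instance : Module ℝ (LipSpace U) := inferInstanceAs (Module ℝ (lipSubmodule U))

/-- The underlying function of an element of `Lip(U)`. -/
def toFun (f : LipSpace U) : U → ℝ := Subtype.val (p := fun g => g ∈ lipSubmodule U) f

instance : CoeFun (LipSpace U) (fun _ => U → ℝ) := ⟨toFun⟩

theorem add_apply (f g : LipSpace U) (x : U) : (f + g) x = f x + g x := rfl

theorem smul_apply (c : ℝ) (f : LipSpace U) (x : U) : (c • f) x = c * f x := rfl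

theorem zero_apply (x : U) : (0 : LipSpace U) x = 0 := rfl

theorem exists_lipschitz (f : LipSpace U) : ∃ k : ℝ≥0, LipschitzWith k f.toFun :=
  Subtype.property (p := fun g => g ∈ lipSubmodule U) f

theorem bddAbove_quotients (f : LipSpace U) :
    BddAbove (Set.range fun p : U × U => |f p.1 - f p.2| / |(p.1 : ℝ) - (p.2 : ℝ)|) := by
  obtain ⟨k, hk⟩ := f.exists_lipschitz
  refine ⟨k, ?_⟩
  rintro _ ⟨p, rfl⟩
  refine div_le_of_le_mul₀ (abs_nonneg _) k.2 ?_
  simpa [Real.dist_eq, Subtype.dist_eq] using hk.dist_le_mul p.1 p.2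

/-- `‖·‖_Lip` as a seminorm on `Lip(U)`. -/
noncomputable def lipSeminorm (U : Set ℝ) : Seminorm ℝ (LipSpace U) :=
  Seminorm.of (fun f => lipSup f.toFun)
    (by
      intro f g
      refine Real.iSup_le (fun p => ?_)
        (add_nonneg (Real.iSup_nonneg fun _ => by positivity)
          (Real.iSup_nonneg fun _ => by positivity))
      refine le_trans ?_ (add_le_add (le_ciSup f.bddAbove_quotients p)
        (le_ciSup g.bddAbove_quotients p))
      rw [← add_div, add_apply, add_apply]
      gcongr
      rw [add_sub_add_comm]
      exact abs_add_le _ _)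
    (by
      intro c f
      simp only [lipSup]
      rw [Real.norm_eq_abs, Real.mul_iSup_of_nonneg (abs_nonneg c)]
      congr 1
      ext p
      rw [smul_apply, smul_apply, ← mul_sub, abs_mul, mul_div_assoc])

noncomputable instance : SeminormedAddCommGroup (LipSpace U) :=
  (lipSeminorm U).toAddGroupSeminorm.toSeminormedAddCommGroup

theorem norm_def (f : LipSpace U) : ‖f‖ = lipSup f.toFun := rfl

noncomputable instance : NormedSpace ℝ (LipSpace U) where
  norm_smul_le c f := le_of_eq (map_smul_eq_mul (lipSeminorm U) c f)

end LipSpace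

/-- `f : U → ℝ` has derivative `d` at the point `x` of `U`. Only the values of `f` on `U` matter,
not those of the extension of `f` by `0`; for open `U` this is the usual derivative. -/
def HasDerivOnAt {U : Set ℝ} (f : U → ℝ) (d : ℝ) (x : U) : Prop :=
  HasDerivWithinAt (Function.extend Subtype.val f 0) d U x

/-- The Clarke subdifferential of `f : U → ℝ` at `x`: the convex envelope of all limits of
derivatives of `f` along sequences of differentiability points that converge to `x`. (Leaving out
a null set of points as well would give the same set for Lipschitz `f`.) -/
def clarkeSubdiff {U : Set ℝ} (f : U → ℝ) (x : U) : Set ℝ :=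
  convexHull ℝ {p : ℝ | ∃ (u : ℕ → U) (d : ℕ → ℝ), (∀ n, HasDerivOnAt f (d n) (u n)) ∧
    Filter.Tendsto u Filter.atTop (𝓝 x) ∧ Filter.Tendsto d Filter.atTop (𝓝 p)}

/-- A Lipschitz function is Clarke exhaustive if every nonempty closed convex subset of the closed
ball of centre `0` and radius `‖f‖_Lip` is its Clarke subdifferential at some point. -/
def ClarkeExhaustive {U : Set ℝ} (f : LipSpace U) : Prop :=
  ∀ K : Set ℝ, K.Nonempty → IsClosed K → Convex ℝ K → K ⊆ Metric.closedBall 0 ‖f‖ →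
    ∃ x : U, clarkeSubdiff f x = K

/-- The everywhere differentiable, Clarke exhaustive Lipschitz functions on `U`. -/
def exhaustiveSet (U : Set ℝ) : Set (LipSpace U) :=
  {f | (∀ x : U, ∃ d : ℝ, HasDerivOnAt f d x) ∧ ClarkeExhaustive f}

/-- The open interval `(a, b)` of real numbers, with possibly infinite end points. -/
def openInterval (a b : EReal) : Set ℝ := {t : ℝ | a < (t : EReal) ∧ (t : EReal) < b}

/-- A subset of a seminormed space is spaceable if it contains a closed infinite-dimensional
linear subspace. -/
def IsSpaceable {X : Type*} [SeminormedAddCommGroup X] [NormedSpace ℝ X] (E : Set X) : Prop :=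
  ∃ W : Submodule ℝ X, IsClosed (W : Set X) ∧ ¬ FiniteDimensional ℝ W ∧ (W : Set X) ⊆ E

/-- The data of the construction on `(a, b)`: intervals `(α n, β n)` with
`a < α n < β n < α (n + 1) < b`, and everywhere differentiable, Clarke exhaustive functions `f n`
with `‖f n‖_Lip = 1` whose (closed) supports lie in `(α n, β n)`. -/
structure IsDisjointExhaustiveSeq (a b : EReal) (α β : ℕ → ℝ)
    (f : ℕ → LipSpace (openInterval a b)) : Prop where
  left_lt : ∀ n, a < (α n : EReal)
  lt : ∀ n, α n < β n
  lt_succ : ∀ n, β n < α (n + 1)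
  lt_right : ∀ n, (β n : EReal) < b
  mem : ∀ n, f n ∈ exhaustiveSet (openInterval a b)
  norm_eq : ∀ n, ‖f n‖ = 1
  supp : ∀ n, tsupport (f n).toFun ⊆ {t | (t : ℝ) ∈ Set.Ioo (α n) (β n)}

/-!
Fix a nowhere dense copy `S` of the Cantor set on the line. Gluing rescaled copies of a primitive of
`cos (1 / s)` into the gaps of `S` gives a differentiable function whose derivative `w` oscillates
between `-1` and `1` at every point of `S`. For continuous, compactly supported functions `C` and
`D`, the function `(C + D) / 2 + (D - C) / 2 * w` is again a derivative, and its cluster set at a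
point `x` of `S` with `C x ≤ D x` is `[C x, D x]`. Since the Cantor set maps continuously onto the
square of all end point pairs, every subinterval of `[-1, 1]` occurs. Subtracting a translate makes
the primitive compactly supported.

The map `x ↦ ∑ n, x n * f n` is isometric because the supremum norm of `x ∈ c₀` is attained at some
`n`, and on the support of `f n` the sum is `x n * f n`, which already realises all closed convex
sets required of the sum. As `c₀` is complete, the closure of the image consists of the functions at
seminorm distance `0` from it; these differ from its elements by constants and therefore have the
same subdifferentials.
-/

section ClusterSet

variable {X Y Z : Type*} [TopologicalSpace X] [TopologicalSpace Y] [TopologicalSpace Z]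

/-- The cluster set of `g` at `x`: all limits of `g` along ultrafilters converging to `x`. For an
everywhere differentiable `f` on the line, the Clarke subdifferential is the convex hull of the
cluster set of the derivative. The value `g x` itself always belongs to the cluster set. -/
def clusterSet (g : X → Y) (x : X) : Set Y := {y | MapClusterPt y (𝓝 x) g}

theorem mem_clusterSet_iff_mem_closure {g : X → Y} {x : X} {y : Y} :
    y ∈ clusterSet g x ↔ (x, y) ∈ closure {q : X × Y | g q.1 = q.2} := by
  rw [clusterSet, Set.mem_ofPred_eq, mapClusterPt_iff_frequently,
    mem_closure_iff_nhds_basis ((𝓝 x).basis_sets.prod_nhds (𝓝 y).basis_sets)]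
  simp only [Filter.frequently_iff]
  constructor
  · rintro h ⟨V, W⟩ ⟨hV, hW⟩
    obtain ⟨a, haV, haW⟩ := h W hW hV
    exact ⟨(a, g a), rfl, haV, haW⟩
  · intro h W hW V hV
    obtain ⟨⟨a, b⟩, hab, haV, haW⟩ := h (V, W) ⟨hV, hW⟩
    exact ⟨a, haV, (show g a = b from hab) ▸ haW⟩

theorem isClosed_setOf_mem_clusterSet (g : X → Y) (y : Y) : IsClosed {x | y ∈ clusterSet g x} := by
  simp only [mem_clusterSet_iff_mem_closure]
  exact isClosed_closure.preimage (Continuous.prodMk_left y)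

theorem clusterSet_congr {g h : X → Y} {x : X} (hgh : g =ᶠ[𝓝 x] h) :
    clusterSet g x = clusterSet h x := by
  simp only [clusterSet, MapClusterPt, Filter.map_congr hgh]

theorem clusterSet_comp_subtypeVal {U : Set X} (hU : IsOpen U) (g : X → Y) (x : U) :
    clusterSet (g ∘ Subtype.val) x = clusterSet g x := by
  simp only [clusterSet, MapClusterPt, ← Filter.map_map,
    hU.isOpenEmbedding_subtypeVal.map_nhds_eq]

theorem clusterSet_subset_of_isClosed {g : X → Y} {C : Set Y} (hC : IsClosed C)
    (hg : ∀ t, g t ∈ C) (x : X) : clusterSet g x ⊆ C := fun _ hy =>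
  hC.mem_of_mapClusterPt hy (Filter.Eventually.of_forall hg)

theorem clusterSet_comp_prodMk_of_isCompact [T2Space Z] {g : X → Y} {K : Set Y} (hK : IsCompact K)
    (hg : ∀ t, g t ∈ K) {Φ : X × Y → Z} (hΦ : Continuous Φ) (x : X) :
    clusterSet (fun t => Φ (t, g t)) x = (fun y => Φ (x, y)) '' clusterSet g x := by
  ext z
  simp only [clusterSet, Set.mem_ofPred_eq, Set.mem_image, mapClusterPt_iff_ultrafilter]
  constructor
  · rintro ⟨l, hl, hz⟩
    obtain ⟨y, -, hy⟩ := hK.ultrafilter_le_nhds' (l.map g)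
      (Filter.mem_map.2 (Filter.univ_mem' hg))
    exact ⟨y, ⟨l, hl, hy⟩, tendsto_nhds_unique
      ((hΦ.tendsto (x, y)).comp (Filter.Tendsto.prodMk_nhds hl hy)) hz⟩
  · rintro ⟨y, ⟨l, hl, hy⟩, rfl⟩
    exact ⟨l, hl, (hΦ.tendsto (x, y)).comp (Filter.Tendsto.prodMk_nhds hl hy)⟩

theorem clusterSet_const [T1Space Y] (c : Y) (x : X) : clusterSet (fun _ : X => c) x = {c} :=
  Set.Subset.antisymm (clusterSet_subset_of_isClosed isClosed_singleton (fun _ => rfl) x)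
    (Set.singleton_subset_iff.2 tendsto_const_nhds.mapClusterPt)

end ClusterSet

theorem interior_eq_empty_of_isTotallyDisconnected {X : Type*} [TopologicalSpace X]
    [LocallyConnectedSpace X] [T1Space X] [PerfectSpace X] {S : Set X}
    (hS : IsTotallyDisconnected S) : interior S = ∅ := by
  refine Set.eq_empty_of_forall_notMem fun x hx => ?_
  obtain ⟨V, hVS, hV, hxV, hVc⟩ := locallyConnectedSpace_iff_subsets_isOpen_isConnected.1
    inferInstance x S (mem_interior_iff_mem_nhds.1 hx)
  exact infinite_of_mem_nhds x (hV.mem_nhds hxV) (hS V hVS hVc.isPreconnected).finite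

theorem exists_inseparable_of_mem_closure {X : Type*} [UniformSpace X] {s : Set X}
    (hs : IsComplete s) {x : X} (hx : x ∈ closure s) : ∃ y ∈ s, Inseparable x y := by
  have := mem_closure_iff_nhdsWithin_neBot.1 hx
  obtain ⟨y, hy, hxy⟩ := hs (𝓝[s] x) (cauchy_nhds.mono nhdsWithin_le_nhds)
    (Filter.le_principal_iff.2 self_mem_nhdsWithin)
  exact ⟨y, hy, tendsto_nhds_unique_inseparable (f := id)
    (Filter.tendsto_id'.2 nhdsWithin_le_nhds) (Filter.tendsto_id'.2 hxy)⟩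

section CosInv

open Real

theorem continuous_mul_sin_inv : Continuous fun s : ℝ => s * sin s⁻¹ := by
  refine continuous_iff_continuousAt.2 fun s => ?_
  rcases eq_or_ne s 0 with rfl | hs
  · rw [ContinuousAt, zero_mul]
    simpa only [mul_comm, id_eq] using bdd_le_mul_tendsto_zero' 1
      (Filter.Eventually.of_forall fun s : ℝ => abs_sin_le_one s⁻¹) (Filter.tendsto_id (x := 𝓝 0))
  · fun_prop (disch := assumption)

theorem hasDerivAt_sq_mul_sin_inv_zero : HasDerivAt (fun s : ℝ => s ^ 2 * sin s⁻¹) 0 0 := by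
  rw [hasDerivAt_iff_tendsto_slope]
  refine ((continuous_mul_sin_inv.tendsto' 0 0 (by simp)).mono_left nhdsWithin_le_nhds).congr' ?_
  filter_upwards [self_mem_nhdsWithin] with s hs
  have hs : s ≠ 0 := hs
  simp only [slope_def_field]
  field_simp
  ring

theorem hasDerivAt_sq_mul_sin_inv {s : ℝ} (hs : s ≠ 0) :
    HasDerivAt (fun s : ℝ => s ^ 2 * sin s⁻¹) (2 * (s * sin s⁻¹) - cos s⁻¹) s := by
  refine ((hasDerivAt_pow 2 s).fun_mul (hasDerivAt_inv hs).sin).congr_deriv ?_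
  field_simp
  ring

/-- The primitive of `cos (1 / s)` that vanishes at `0`, after integrating by parts so that the
integrand is continuous. -/
noncomputable def cosInvPrimitive (s : ℝ) : ℝ :=
  (∫ r in (0 : ℝ)..s, 2 * (r * sin r⁻¹)) - s ^ 2 * sin s⁻¹

theorem cosInvPrimitive_zero : cosInvPrimitive 0 = 0 := by simp [cosInvPrimitive]

theorem hasDerivAt_integral_mul_sin_inv (s : ℝ) :
    HasDerivAt (fun s => ∫ r in (0 : ℝ)..s, 2 * (r * sin r⁻¹)) (2 * (s * sin s⁻¹)) s :=
  ((continuous_mul_sin_inv.const_mul 2).integral_hasStrictDerivAt 0 s).hasDerivAt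

theorem hasDerivAt_cosInvPrimitive_zero : HasDerivAt cosInvPrimitive 0 0 :=
  ((hasDerivAt_integral_mul_sin_inv 0).fun_sub hasDerivAt_sq_mul_sin_inv_zero).congr_deriv
    (by simp)

theorem hasDerivAt_cosInvPrimitive {s : ℝ} (hs : s ≠ 0) :
    HasDerivAt cosInvPrimitive (cos s⁻¹) s :=
  ((hasDerivAt_integral_mul_sin_inv s).fun_sub (hasDerivAt_sq_mul_sin_inv hs)).congr_deriv
    (by ring)

theorem mapClusterPt_cos_atTop {σ : ℝ} (hσ : σ ∈ Set.Icc (-1) 1) :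
    MapClusterPt σ Filter.atTop cos := by
  refine .of_comp (p := Filter.atTop) (φ := fun n : ℕ => arccos σ + n * (2 * π)) ?_ ?_
  · exact Filter.tendsto_atTop_add_const_left _ _
      (tendsto_natCast_atTop_atTop.atTop_mul_const two_pi_pos)
  · have : cos ∘ (fun n : ℕ => arccos σ + n * (2 * π)) = fun _ => σ := by
      ext n
      simp only [Function.comp_apply, cos_add_nat_mul_two_pi, cos_arccos hσ.1 hσ.2]
    exact this ▸ tendsto_const_nhds.mapClusterPt

end CosInv

/-- `(u, v)` is a gap of `S`: a bounded complementary interval whose end points lie in `S`. -/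
structure IsGap (S : Set ℝ) (u v : ℝ) : Prop where
  left_mem : u ∈ S
  right_mem : v ∈ S
  lt : u < v
  notMem : ∀ s ∈ Set.Ioo u v, s ∉ S

theorem exists_isGap_mem {S : Set ℝ} (hS : IsClosed S) (hb : ¬BddBelow S) (ha : ¬BddAbove S)
    {t : ℝ} (ht : t ∉ S) : ∃ u v, IsGap S u v ∧ t ∈ Set.Ioo u v := by
  obtain ⟨u₀, hu₀, hut⟩ := not_bddBelow_iff.1 hb t
  obtain ⟨v₀, hv₀, htv⟩ := not_bddAbove_iff.1 ha t
  have hba : BddAbove (S ∩ Set.Iic t) := bddAbove_Iic.mono Set.inter_subset_right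
  have hbb : BddBelow (S ∩ Set.Ici t) := bddBelow_Ici.mono Set.inter_subset_right
  have hu := (hS.inter isClosed_Iic).csSup_mem ⟨u₀, hu₀, hut.le⟩ hba
  have hv := (hS.inter isClosed_Ici).csInf_mem ⟨v₀, hv₀, htv.le⟩ hbb
  have hut' : sSup (S ∩ Set.Iic t) < t := lt_of_le_of_ne hu.2 fun h => ht (h ▸ hu.1)
  have htv' : t < sInf (S ∩ Set.Ici t) := lt_of_le_of_ne hv.2 fun h => ht (h ▸ hv.1)
  refine ⟨_, _, ⟨hu.1, hv.1, hut'.trans htv', fun s hs hsS => ?_⟩, hut', htv'⟩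
  rcases le_total s t with h | h
  · exact (le_csSup hba ⟨hsS, h⟩).not_gt hs.1
  · exact (csInf_le hbb ⟨hsS, h⟩).not_gt hs.2

/-- The number `(t - u) * (v - t) / (v - u)` for `t` in a gap `(u, v)` of `S`, and `0` for
`t ∈ S`. The end points `u` and `v` are the closest points of `S` on both sides of `t`, so that no
choice of gaps enters the definition. -/
noncomputable def gapProfile (S : Set ℝ) (t : ℝ) : ℝ :=
  (t - sSup (S ∩ Set.Iic t)) * (sInf (S ∩ Set.Ici t) - t) /
    (sInf (S ∩ Set.Ici t) - sSup (S ∩ Set.Iic t))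

theorem gapProfile_of_mem {S : Set ℝ} {t : ℝ} (ht : t ∈ S) : gapProfile S t = 0 := by
  have h : IsGreatest (S ∩ Set.Iic t) t := ⟨⟨ht, Set.self_mem_Iic⟩, fun _ h => h.2⟩
  rw [gapProfile, h.csSup_eq, sub_self, zero_mul, zero_div]

/-- A primitive of a derivative that oscillates between `-1` and `1` at the end points of every gap
of `S`. -/
noncomputable def oscillator (S : Set ℝ) : ℝ → ℝ := cosInvPrimitive ∘ gapProfile S

namespace IsGap

variable {S : Set ℝ} {u v t : ℝ}

theorem le_or_le (h : IsGap S u v) {x : ℝ} (hx : x ∈ S) : x ≤ u ∨ v ≤ x := by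
  by_contra! hxuv
  exact h.notMem x hxuv hx

theorem gapProfile_eq (h : IsGap S u v) (ht : t ∈ Set.Ioo u v) :
    gapProfile S t = (t - u) * (v - t) / (v - u) := by
  have hu : IsGreatest (S ∩ Set.Iic t) u :=
    ⟨⟨h.left_mem, ht.1.le⟩, fun _ hs => (h.le_or_le hs.1).resolve_right
      (hs.2.trans_lt ht.2).not_ge⟩
  have hv : IsLeast (S ∩ Set.Ici t) v :=
    ⟨⟨h.right_mem, ht.2.le⟩, fun _ hs => (h.le_or_le hs.1).resolve_left
      (ht.1.trans_le hs.2).not_ge⟩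
  rw [gapProfile, hu.csSup_eq, hv.csInf_eq]

theorem gapProfile_pos (h : IsGap S u v) (ht : t ∈ Set.Ioo u v) : 0 < gapProfile S t := by
  rw [h.gapProfile_eq ht]
  exact div_pos (mul_pos (sub_pos.2 ht.1) (sub_pos.2 ht.2)) (sub_pos.2 h.lt)

theorem gapProfile_le_sub_left (h : IsGap S u v) (ht : t ∈ Set.Ioo u v) :
    gapProfile S t ≤ t - u := by
  rw [h.gapProfile_eq ht, div_le_iff₀ (sub_pos.2 h.lt)]
  exact mul_le_mul_of_nonneg_left (by linarith [ht.1]) (sub_pos.2 ht.1).le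

theorem gapProfile_le_right_sub (h : IsGap S u v) (ht : t ∈ Set.Ioo u v) :
    gapProfile S t ≤ v - t := by
  rw [h.gapProfile_eq ht, div_le_iff₀ (sub_pos.2 h.lt), mul_comm]
  exact mul_le_mul_of_nonneg_left (by linarith [ht.2]) (sub_pos.2 ht.2).le

theorem hasDerivAt_gapProfile (h : IsGap S u v) (ht : t ∈ Set.Ioo u v) :
    HasDerivAt (gapProfile S) ((u + v - 2 * t) / (v - u)) t := by
  have hP : HasDerivAt (fun t => (t - u) * (v - t) / (v - u)) ((u + v - 2 * t) / (v - u)) t :=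
    ((((hasDerivAt_id' t).sub_const u).fun_mul ((hasDerivAt_id' t).const_sub v)).div_const
      (v - u)).congr_deriv (by ring)
  exact hP.congr_of_eventuallyEq
    (Filter.eventually_of_mem (Ioo_mem_nhds ht.1 ht.2) fun _ => h.gapProfile_eq)

theorem hasDerivAt_oscillator (h : IsGap S u v) (ht : t ∈ Set.Ioo u v) :
    HasDerivAt (oscillator S)
      (Real.cos (gapProfile S t)⁻¹ * ((u + v - 2 * t) / (v - u))) t :=
  (hasDerivAt_cosInvPrimitive (h.gapProfile_pos ht).ne').comp t (h.hasDerivAt_gapProfile ht)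

theorem abs_deriv_oscillator_le_one (h : IsGap S u v) (ht : t ∈ Set.Ioo u v) :
    |deriv (oscillator S) t| ≤ 1 := by
  have hslope : |(u + v - 2 * t) / (v - u)| ≤ 1 := by
    rw [abs_div, abs_of_pos (sub_pos.2 h.lt), div_le_one (sub_pos.2 h.lt), abs_le]
    constructor <;> linarith [ht.1, ht.2]
  rw [(h.hasDerivAt_oscillator ht).deriv, abs_mul]
  exact mul_le_one₀ (Real.abs_cos_le_one _) (abs_nonneg _) hslope

theorem tendsto_inv_gapProfile (h : IsGap S u v) :
    Filter.Tendsto (fun t => (gapProfile S t)⁻¹) (𝓝[>] u) Filter.atTop := by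
  have hsub : Filter.Tendsto (fun t => t - u) (𝓝[>] u) (𝓝 0) :=
    ((continuous_id.sub continuous_const).tendsto' u 0 (sub_self u)).mono_left nhdsWithin_le_nhds
  have hIoo : ∀ᶠ t in 𝓝[>] u, t ∈ Set.Ioo u v := Ioo_mem_nhdsGT h.lt
  refine Filter.Tendsto.inv_tendsto_nhdsGT_zero (tendsto_nhdsWithin_iff.2 ⟨?_, ?_⟩)
  · exact squeeze_zero' (hIoo.mono fun t ht => (h.gapProfile_pos ht).le)
      (hIoo.mono fun t ht => h.gapProfile_le_sub_left ht) hsub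
  · exact hIoo.mono fun t ht => h.gapProfile_pos ht

theorem atTop_le_map_inv_gapProfile (h : IsGap S u v) :
    Filter.atTop ≤ Filter.map (fun t => (gapProfile S t)⁻¹) (𝓝[>] u) := by
  intro s hs
  obtain ⟨w, huw, hws⟩ := (mem_nhdsGT_iff_exists_Ioo_subset' h.lt).1 (Filter.mem_map.1 hs)
  obtain ⟨c, huc, hc⟩ := exists_between (lt_min (show u < w from huw) h.lt)
  have hcw : Set.Ioc u c ⊆ Set.Ioo u w := fun t ht =>
    ⟨ht.1, ht.2.trans_lt (hc.trans_le (min_le_left w v))⟩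
  have hcv : Set.Ioc u c ⊆ Set.Ioo u v := fun t ht =>
    ⟨ht.1, ht.2.trans_lt (hc.trans_le (min_le_right w v))⟩
  have hcont : ContinuousOn (fun t => (gapProfile S t)⁻¹) (Set.Ioc u c) := fun t ht =>
    ((h.hasDerivAt_gapProfile (hcv ht)).continuousAt.inv₀
      (h.gapProfile_pos (hcv ht)).ne').continuousWithinAt
  refine Filter.mem_of_superset (Filter.Ici_mem_atTop (gapProfile S c)⁻¹) fun y hy => ?_
  obtain ⟨t, ht, rfl⟩ := isPreconnected_Ioc.intermediate_value_Ici ⟨huc, le_rfl⟩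
    (Filter.le_principal_iff.2 (Ioc_mem_nhdsGT huc)) hcont h.tendsto_inv_gapProfile hy
  exact hws (hcw ht)

theorem mem_clusterSet_deriv_oscillator_left (h : IsGap S u v) {σ : ℝ} (hσ : σ ∈ Set.Icc (-1) 1) :
    σ ∈ clusterSet (deriv (oscillator S)) u := by
  have hcos : MapClusterPt σ (𝓝[>] u) fun t => Real.cos (gapProfile S t)⁻¹ :=
    (mapClusterPt_cos_atTop hσ).mono h.atTop_le_map_inv_gapProfile
  have hslope : Filter.Tendsto (fun t => (u + v - 2 * t) / (v - u)) (𝓝[>] u) (𝓝 1) := by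
    have : Continuous fun t => (u + v - 2 * t) / (v - u) := by fun_prop
    refine (this.tendsto' u 1 ?_).mono_left nhdsWithin_le_nhds
    rw [div_eq_one_iff_eq (sub_pos.2 h.lt).ne']
    ring
  have hderiv : (fun t => Real.cos (gapProfile S t)⁻¹ * ((u + v - 2 * t) / (v - u)))
      =ᶠ[𝓝[>] u] deriv (oscillator S) :=
    Filter.eventually_of_mem (Ioo_mem_nhdsGT h.lt) fun t ht =>
      (h.hasDerivAt_oscillator ht).deriv.symm
  obtain ⟨l, hl, hlσ⟩ := mapClusterPt_iff_ultrafilter.1 hcos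
  have hmul := hlσ.mul (hslope.mono_left hl)
  rw [mul_one] at hmul
  exact mapClusterPt_iff_ultrafilter.2
    ⟨l, hl.trans nhdsWithin_le_nhds, hmul.congr' (hderiv.filter_mono hl)⟩

end IsGap

section Oscillator

variable {S : Set ℝ} (hS : IsClosed S) (hb : ¬BddBelow S) (ha : ¬BddAbove S)

include hS hb ha

theorem abs_gapProfile_le_abs_sub {x : ℝ} (hx : x ∈ S) (t : ℝ) :
    |gapProfile S t| ≤ |t - x| := by
  by_cases ht : t ∈ S
  · rw [gapProfile_of_mem ht, abs_zero]
    exact abs_nonneg _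
  · obtain ⟨u, v, h, htuv⟩ := exists_isGap_mem hS hb ha ht
    rw [abs_of_pos (h.gapProfile_pos htuv), le_abs]
    rcases h.le_or_le hx with hxu | hvx
    · exact .inl ((h.gapProfile_le_sub_left htuv).trans (by linarith))
    · exact .inr ((h.gapProfile_le_right_sub htuv).trans (by linarith))

theorem hasDerivAt_oscillator_of_mem {x : ℝ} (hx : x ∈ S) : HasDerivAt (oscillator S) 0 x := by
  have hψ := hasDerivAt_cosInvPrimitive_zero
  have hO : gapProfile S =O[𝓝 x] fun t => t - x := .of_bound 1 <| .of_forall fun t => by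
    simpa only [one_mul, Real.norm_eq_abs] using abs_gapProfile_le_abs_sub hS hb ha hx t
  have hto : Filter.Tendsto (gapProfile S) (𝓝 x) (𝓝 0) :=
    hO.trans_tendsto ((continuous_id.sub continuous_const).tendsto' x 0 (sub_self x))
  rw [hasDerivAt_iff_isLittleO] at hψ ⊢
  simp only [cosInvPrimitive_zero, sub_zero, smul_zero] at hψ
  simp only [oscillator, Function.comp_apply, gapProfile_of_mem hx, cosInvPrimitive_zero, sub_zero,
    smul_zero]
  exact (hψ.comp_tendsto hto).trans_isBigO hO

theorem differentiable_oscillator : Differentiable ℝ (oscillator S) := fun t => by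
  by_cases ht : t ∈ S
  · exact (hasDerivAt_oscillator_of_mem hS hb ha ht).differentiableAt
  · obtain ⟨u, v, h, htuv⟩ := exists_isGap_mem hS hb ha ht
    exact (h.hasDerivAt_oscillator htuv).differentiableAt

theorem abs_deriv_oscillator_le_one (t : ℝ) : |deriv (oscillator S) t| ≤ 1 := by
  by_cases ht : t ∈ S
  · rw [(hasDerivAt_oscillator_of_mem hS hb ha ht).deriv, abs_zero]
    exact zero_le_one
  · obtain ⟨u, v, h, htuv⟩ := exists_isGap_mem hS hb ha ht
    exact h.abs_deriv_oscillator_le_one htuv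

theorem subset_closure_setOf_isGap (hi : interior S = ∅) :
    S ⊆ closure {u | ∃ v, IsGap S u v} := fun x hx => by
  refine Metric.mem_closure_iff.2 fun ε hε => ?_
  obtain ⟨t, htS, hxt, htε⟩ :=
    (interior_eq_empty_iff_dense_compl.1 hi).exists_between (lt_add_of_pos_right x hε)
  obtain ⟨u, v, h, htuv⟩ := exists_isGap_mem hS hb ha htS
  have hxu : x ≤ u := (h.le_or_le hx).resolve_right (hxt.trans htuv.2).not_ge
  refine ⟨u, ⟨v, h⟩, ?_⟩
  rw [dist_comm, Real.dist_eq, abs_of_nonneg (sub_nonneg.2 hxu)]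
  linarith [htuv.1]

theorem clusterSet_deriv_oscillator (hi : interior S = ∅) {x : ℝ} (hx : x ∈ S) :
    clusterSet (deriv (oscillator S)) x = Metric.closedBall 0 1 := by
  refine (clusterSet_subset_of_isClosed Metric.isClosed_closedBall (fun t =>
    mem_closedBall_zero_iff.2 (abs_deriv_oscillator_le_one hS hb ha t)) x).antisymm fun σ hσ => ?_
  rw [Real.closedBall_eq_Icc, zero_sub, zero_add] at hσ
  have hgap : {u | ∃ v, IsGap S u v} ⊆ {y | σ ∈ clusterSet (deriv (oscillator S)) y} :=
    fun _ ⟨_, h⟩ => h.mem_clusterSet_deriv_oscillator_left hσ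
  exact closure_minimal hgap (isClosed_setOf_mem_clusterSet _ σ)
    (subset_closure_setOf_isGap hS hb ha hi hx)

end Oscillator

section Product

open MeasureTheory

theorem intervalIntegrable_smul_deriv {E : Type*} [NormedAddCommGroup E] [NormedSpace ℝ E]
    [CompleteSpace E] {W : ℝ → E} {M : ℝ} (hM : ∀ t, ‖deriv W t‖ ≤ M) {g : ℝ → ℝ}
    (hg : Continuous g) (a b : ℝ) : IntervalIntegrable (fun s => g s • deriv W s) volume a b :=
  (intervalIntegrable_const (c := M)).mono_fun (stronglyMeasurable_deriv W).aestronglyMeasurable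
    (.of_forall fun t => (hM t).trans (le_abs_self M)) |>.continuousOn_smul hg.continuousOn

theorem hasDerivAt_integral_smul_deriv {E : Type*} [NormedAddCommGroup E] [NormedSpace ℝ E]
    [CompleteSpace E] {W : ℝ → E} (hW : Differentiable ℝ W) {M : ℝ} (hM : ∀ t, ‖deriv W t‖ ≤ M)
    {g : ℝ → ℝ} (hg : Continuous g) (a x : ℝ) :
    HasDerivAt (fun t => ∫ s in a..t, g s • deriv W s) (g x • deriv W x) x := by
  have hint {g : ℝ → ℝ} (hg : Continuous g) (t : ℝ) :
      IntervalIntegrable (fun s => g s • deriv W s) volume a t :=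
    intervalIntegrable_smul_deriv hM hg a t
  have hsub : Continuous fun s => g s - g x := hg.sub continuous_const
  have hzero : ContinuousAt (fun s => (g s - g x) • deriv W s) x := by
    rw [ContinuousAt, sub_self, zero_smul]
    exact (hsub.tendsto' x 0 (sub_self _)).zero_smul_isBoundedUnder_le
      (Filter.isBoundedUnder_of ⟨M, hM⟩)
  have hosc : HasDerivAt (fun t => ∫ s in a..t, (g s - g x) • deriv W s) 0 x := by
    simpa only [sub_self, zero_smul] using intervalIntegral.integral_hasDerivAt_right (hint hsub x)
      ((hsub.stronglyMeasurable.smul (stronglyMeasurable_deriv W)).stronglyMeasurableAtFilter) hzero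
  have hlin : HasDerivAt (fun t => g x • (W t - W a)) (g x • deriv W x) x :=
    ((hW x).hasDerivAt.sub_const (W a)).const_smul (g x)
  refine (hosc.add hlin).congr_deriv (zero_add _) |>.congr_of_eventuallyEq (.of_forall fun t => ?_)
  have hftc : ∫ s in a..t, deriv W s = W t - W a :=
    intervalIntegral.integral_deriv_eq_sub (fun s _ => hW s) (by
      simpa only [one_smul] using hint continuous_const (g := fun _ => 1) t)
  simp only [Pi.add_apply, sub_smul]
  rw [intervalIntegral.integral_sub (hint hg t) (hint continuous_const t),
    intervalIntegral.integral_smul, hftc, sub_add_cancel]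

end Product

theorem exists_isClosedEmbedding_nat_bool {p q : ℝ} (hpq : p < q) : ∃ e : (ℕ → Bool) → ℝ,
    Topology.IsClosedEmbedding e ∧ Set.range e ⊆ Set.Ioo p q ∧ interior (Set.range e) = ∅ := by
  obtain ⟨p', hpp', hp'q⟩ := exists_between hpq
  obtain ⟨q', hp'q', hq'q⟩ := exists_between hp'q
  obtain ⟨e, hrange, hcont, hinj⟩ :=
    (isClosed_Icc (a := p') (b := q')).exists_nat_bool_injection_of_not_countable
      (Cardinal.Real.Icc_countable_iff.not.2 hp'q'.not_ge)
  have he := hcont.isClosedEmbedding hinj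
  exact ⟨e, he, hrange.trans (Set.Icc_subset_Ioo hpp' hq'q),
    interior_eq_empty_of_isTotallyDisconnected
      (he.isEmbedding.isTotallyDisconnected_range.2 inferInstance)⟩

theorem exists_continuous_closedBall_subset_image {E : Type*} [NormedAddCommGroup E]
    [NormedSpace ℝ E] [FiniteDimensional ℝ E] {p q : ℝ} (hpq : p < q) :
    ∃ (S : Set ℝ) (G : ℝ → E), IsClosed S ∧ interior S = ∅ ∧ S ⊆ Set.Ioo p q ∧ Continuous G ∧
      (∀ t, ‖G t‖ ≤ 1) ∧ (∀ t ∉ Set.Ioo p q, G t = 0) ∧ Metric.closedBall 0 1 ⊆ G '' S := by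
  obtain ⟨e, he, heI, hei⟩ := exists_isClosedEmbedding_nat_bool hpq
  have : Nonempty (Metric.closedBall (0 : E) 1) := ⟨0, Metric.mem_closedBall_self zero_le_one⟩
  have : ProperSpace E := FiniteDimensional.proper_real E
  have := Metric.instTietzeExtensionClosedBall ℝ (0 : E) one_pos
  obtain ⟨φ, hφ, hφsurj⟩ :=
    exists_nat_bool_continuous_surjective_of_compact (Metric.closedBall (0 : E) 1)
  obtain ⟨g, hg, hge⟩ := ContinuousMap.exists_extension_forall_mem he
    ⟨fun z => (φ z : E), by fun_prop⟩ fun z => (φ z).2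
  obtain ⟨χ, hχ0, hχ1, hχ⟩ := exists_continuous_zero_one_of_isClosed isOpen_Ioo.isClosed_compl
    he.isClosed_range (Set.disjoint_compl_left_iff_subset.2 heI)
  refine ⟨Set.range e, fun t => χ t • g t, he.isClosed_range, hei, heI, by fun_prop, fun t => ?_,
    fun t ht => ?_, fun y hy => ?_⟩
  · rw [norm_smul, Real.norm_of_nonneg (hχ t).1]
    exact mul_le_one₀ (hχ t).2 (norm_nonneg _) (mem_closedBall_zero_iff.1 (hg t))
  · beta_reduce
    rw [hχ0 ht, Pi.zero_apply, zero_smul]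
  · obtain ⟨z, hz⟩ := hφsurj ⟨y, hy⟩
    have hgz : g (e z) = φ z := DFunLike.congr_fun hge z
    exact ⟨e z, ⟨z, rfl⟩, by simp only [hχ1 ⟨z, rfl⟩, hgz, hz, Pi.one_apply, one_smul]⟩

/-- Every nonempty closed convex subset of `[-1, 1]` is a cluster set of `g` at some point of `s`.
This is Clarke exhaustiveness, at scale `1`, of a function with derivative `g`. -/
def ClusterExhaustiveOn (g : ℝ → ℝ) (s : Set ℝ) : Prop :=
  ∀ K : Set ℝ, K.Nonempty → IsClosed K → Convex ℝ K → K ⊆ Metric.closedBall 0 1 →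
    ∃ x ∈ s, clusterSet g x = K

theorem abs_midpoint_add_mul_le_one {c d w : ℝ} (hc : |c| ≤ 1) (hd : |d| ≤ 1) (hw : |w| ≤ 1) :
    |(c + d) / 2 + (d - c) / 2 * w| ≤ 1 := by
  rw [abs_le] at *
  constructor <;> nlinarith

theorem clusterSet_midpoint_add_mul {X : Type*} [TopologicalSpace X] {C D w : X → ℝ}
    (hC : Continuous C) (hD : Continuous D) (hw : ∀ t, |w t| ≤ 1) {x : X}
    (hwx : clusterSet w x = Metric.closedBall 0 1) (hCD : C x ≤ D x) :
    clusterSet (fun t => (C t + D t) / 2 + (D t - C t) / 2 * w t) x = Set.Icc (C x) (D x) := by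
  rw [clusterSet_comp_prodMk_of_isCompact (isCompact_closedBall (0 : ℝ) 1)
    (fun t => mem_closedBall_zero_iff.2 (hw t))
    (Φ := fun p : X × ℝ => (C p.1 + D p.1) / 2 + (D p.1 - C p.1) / 2 * p.2) (by fun_prop), hwx,
    Real.Icc_eq_closedBall,
    ← affinity_unitClosedBall (r := (D x - C x) / 2) (by linarith) ((C x + D x) / 2)]
  exact (Set.image_image (fun y => (C x + D x) / 2 + y) (fun y => (D x - C x) / 2 * y) _).symm

theorem exists_differentiable_clusterSet_deriv_eq_Icc {S : Set ℝ} (hS : IsClosed S)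
    (hi : interior S = ∅) {C D : ℝ → ℝ} (hC : Continuous C) (hD : Continuous D) :
    ∃ F w : ℝ → ℝ, (∀ t, |w t| ≤ 1) ∧
      (∀ t, HasDerivAt F ((C t + D t) / 2 + (D t - C t) / 2 * w t) t) ∧
      ∀ x ∈ S, C x ≤ D x → clusterSet (deriv F) x = Set.Icc (C x) (D x) := by
  -- Adding the integers makes `S` unbounded on both sides, so that all its gaps are bounded.
  let S' : Set ℝ := Set.range ((↑) : ℤ → ℝ) ∪ S
  have hS' : IsClosed S' := Int.isClosedEmbedding_coe_real.isClosed_range.union hS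
  have hi' : interior S' = ∅ := by
    rw [interior_union_isClosed_of_interior_empty Int.isClosedEmbedding_coe_real.isClosed_range hi]
    exact interior_eq_empty_iff_dense_compl.2 ((Set.countable_range _).dense_compl ℝ)
  have hb : ¬BddBelow S' := not_bddBelow_iff.2 fun t =>
    let ⟨n, hn⟩ := exists_int_lt t
    ⟨n, .inl ⟨n, rfl⟩, hn⟩
  have ha : ¬BddAbove S' := not_bddAbove_iff.2 fun t =>
    let ⟨n, hn⟩ := exists_int_gt t
    ⟨n, .inl ⟨n, rfl⟩, hn⟩
  let w := deriv (oscillator S')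
  have hw : ∀ t, |w t| ≤ 1 := abs_deriv_oscillator_le_one hS' hb ha
  have hA : Continuous fun t => (C t + D t) / 2 := by fun_prop
  have hB : Continuous fun t => (D t - C t) / 2 := by fun_prop
  let F t := (∫ s in (0 : ℝ)..t, (C s + D s) / 2) + ∫ s in (0 : ℝ)..t, (D s - C s) / 2 * w s
  have hF : ∀ t, HasDerivAt F ((C t + D t) / 2 + (D t - C t) / 2 * w t) t := fun t =>
    (hA.integral_hasStrictDerivAt 0 t).hasDerivAt.add
      (hasDerivAt_integral_smul_deriv (differentiable_oscillator hS' hb ha) hw hB 0 t)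
  refine ⟨F, w, hw, hF, fun x hx hCD => ?_⟩
  rw [funext fun t => (hF t).deriv]
  exact clusterSet_midpoint_add_mul hC hD hw
    (clusterSet_deriv_oscillator hS' hb ha hi' (.inr hx)) hCD

theorem exists_differentiable_clusterExhaustiveOn {p q : ℝ} (hpq : p < q) :
    ∃ F : ℝ → ℝ, Differentiable ℝ F ∧ (∀ t, |deriv F t| ≤ 1) ∧
      (∀ t ∉ Set.Ioo p q, deriv F t = 0) ∧ ClusterExhaustiveOn (deriv F) (Set.Ioo p q) := by
  obtain ⟨S, G, hS, hi, hSI, hG, hG1, hG0, hGS⟩ :=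
    exists_continuous_closedBall_subset_image (E := ℝ × ℝ) hpq
  obtain ⟨F, w, hw, hF, hFS⟩ := exists_differentiable_clusterSet_deriv_eq_Icc hS hi hG.fst hG.snd
  refine ⟨F, fun t => (hF t).differentiableAt, fun t => ?_, fun t ht => ?_,
    fun K hKne hKcl hKconv hK1 => ?_⟩
  · have hGt := norm_prod_le_iff.1 (hG1 t)
    rw [(hF t).deriv]
    exact abs_midpoint_add_mul_le_one hGt.1 hGt.2 (hw t)
  · simp [(hF t).deriv, hG0 t ht]
  · have hKcomp := (isCompact_closedBall 0 1).of_isClosed_subset hKcl hK1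
    obtain ⟨x, hxS, hx⟩ := hGS (mem_closedBall_zero_iff.2 (norm_prod_le_iff.2
      ⟨mem_closedBall_zero_iff.1 (hK1 (hKcomp.sInf_mem hKne)),
        mem_closedBall_zero_iff.1 (hK1 (hKcomp.sSup_mem hKne))⟩) : (sInf K, sSup K) ∈ _)
    refine ⟨x, hSI hxS, ?_⟩
    rw [eq_Icc_of_connected_compact ⟨hKne, hKconv.isPreconnected⟩ hKcomp, hFS x hxS, hx]
    rw [hx]
    exact csInf_le_csSup hKne hKcomp.bddBelow hKcomp.bddAbove

theorem eq_of_forall_deriv_eq_zero {F : ℝ → ℝ} (hF : Differentiable ℝ F) {s t : ℝ} (hst : s ≤ t)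
    (h : ∀ r ∈ Set.Ico s t, deriv F r = 0) : F t = F s :=
  constant_of_has_deriv_right_zero hF.continuous.continuousOn
    (fun r hr => h r hr ▸ (hF r).hasDerivAt.hasDerivWithinAt) t (Set.right_mem_Icc.2 hst)

theorem exists_differentiable_tsupport_subset_clusterExhaustiveOn {α β : ℝ} (hαβ : α < β) :
    ∃ H : ℝ → ℝ, Differentiable ℝ H ∧ (∀ t, |deriv H t| ≤ 1) ∧ tsupport H ⊆ Set.Ioo α β ∧
      ClusterExhaustiveOn (deriv H) (Set.Ioo α β) := by
  obtain ⟨l, hl, rfl⟩ : ∃ l > 0, β = α + 4 * l := ⟨(β - α) / 4, by linarith, by ring⟩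
  obtain ⟨F, hF, hF1, hF0, hFK⟩ :=
    exists_differentiable_clusterExhaustiveOn (show α + l < α + 2 * l by linarith)
  have hH : ∀ t, HasDerivAt (fun t => F t - F (t - l)) (deriv F t - deriv F (t - l)) t := fun t =>
    (hF t).hasDerivAt.fun_sub ((hF (t - l)).hasDerivAt.comp_sub_const t l)
  have hleft : ∀ t < α + 2 * l, deriv F t - deriv F (t - l) = deriv F t := fun t ht => by
    rw [hF0 (t - l) fun h => by linarith [h.1], sub_zero]
  refine ⟨fun t => F t - F (t - l), fun t => (hH t).differentiableAt, fun t => ?_, ?_,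
    fun K hKne hKcl hKconv hK1 => ?_⟩
  · rw [(hH t).deriv]
    rcases lt_or_ge t (α + 2 * l) with ht | ht
    · rw [hleft t ht]
      exact hF1 t
    · rw [hF0 t fun h => h.2.not_ge ht, zero_sub, abs_neg]
      exact hF1 _
  · refine (closure_minimal ?_ isClosed_Icc).trans
      (Set.Icc_subset_Ioo (show α < α + l by linarith) (show α + 3 * l < α + 4 * l by linarith))
    refine Function.support_subset_iff'.2 fun t ht => sub_eq_zero.2 ?_
    refine eq_of_forall_deriv_eq_zero hF (by linarith) fun r hr => hF0 r fun hr' => ht ?_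
    exact ⟨by linarith [hr.2, hr'.1], by linarith [hr.1, hr'.2]⟩
  · obtain ⟨x, hx, hxK⟩ := hFK K hKne hKcl hKconv hK1
    refine ⟨x, Set.Ioo_subset_Ioo (by linarith) (by linarith) hx, ?_⟩
    rw [← hxK, funext fun t => (hH t).deriv]
    exact clusterSet_congr (Filter.eventually_of_mem (Iio_mem_nhds hx.2) hleft)

section HasDerivOnAt

variable {U : Set ℝ} {f g : U → ℝ} {d e : ℝ} {x : U}

theorem extend_subtype_val_apply (f : U → ℝ) (x : U) :
    Function.extend Subtype.val f 0 (x : ℝ) = f x :=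
  Subtype.val_injective.extend_apply f 0 x

theorem hasDerivOnAt_iff_hasDerivAt (hU : IsOpen U) {F : ℝ → ℝ} (hfF : ∀ y : U, f y = F y) :
    HasDerivOnAt f d x ↔ HasDerivAt F d x := by
  have h : ∀ y ∈ U, Function.extend Subtype.val f 0 y = F y := fun y hy =>
    (extend_subtype_val_apply f ⟨y, hy⟩).trans (hfF ⟨y, hy⟩)
  exact ⟨fun hf => (HasDerivWithinAt.congr_of_mem hf (fun y hy => (h y hy).symm) x.2).hasDerivAt
    (hU.mem_nhds x.2), fun hF => hF.hasDerivWithinAt.congr_of_mem h x.2⟩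

theorem hasDerivOnAt_iff_isLittleO :
    HasDerivOnAt f d x ↔
      (fun y : U => f y - f x - ((y : ℝ) - x) * d) =o[𝓝 x] fun y : U => (y : ℝ) - x := by
  rw [HasDerivOnAt, hasDerivWithinAt_iff_isLittleO, nhdsWithin_eq_map_subtype_coe x.2,
    Asymptotics.isLittleO_map]
  simp only [Function.comp_def, extend_subtype_val_apply, smul_eq_mul]

theorem hasDerivOnAt_congr (h : f =ᶠ[𝓝 x] g) : HasDerivOnAt f d x ↔ HasDerivOnAt g d x := by
  rw [hasDerivOnAt_iff_isLittleO, hasDerivOnAt_iff_isLittleO]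
  refine Asymptotics.isLittleO_congr (h.mono fun y hy => ?_) .rfl
  beta_reduce
  rw [hy, h.self_of_nhds]

theorem hasDerivOnAt_zero (x : U) : HasDerivOnAt (fun _ : U => (0 : ℝ)) 0 x :=
  hasDerivOnAt_iff_isLittleO.2 (by simp only [sub_self, mul_zero, Asymptotics.isLittleO_zero])

namespace HasDerivOnAt

theorem hasDerivAt (hU : IsOpen U) (h : HasDerivOnAt f d x) :
    HasDerivAt (Function.extend Subtype.val f 0) d x :=
  (hasDerivOnAt_iff_hasDerivAt hU fun y => (extend_subtype_val_apply f y).symm).1 h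

theorem unique (hU : IsOpen U) (h : HasDerivOnAt f d x) (h' : HasDerivOnAt f e x) : d = e :=
  (h.hasDerivAt hU).unique (h'.hasDerivAt hU)

theorem const_mul (c : ℝ) (h : HasDerivOnAt f d x) :
    HasDerivOnAt (fun t => c * f t) (c * d) x := by
  rw [hasDerivOnAt_iff_isLittleO] at h ⊢
  exact (h.const_mul_left c).congr_left fun y => by ring

end HasDerivOnAt

theorem hasDerivOnAt_add_const_iff (c : ℝ) :
    HasDerivOnAt (fun t => f t + c) d x ↔ HasDerivOnAt f d x := by
  simp only [hasDerivOnAt_iff_isLittleO, add_sub_add_right_eq_sub]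

theorem abs_sub_le_of_hasDerivOnAt (hU : Convex ℝ U) {C : ℝ}
    (h : ∀ x, ∃ d, HasDerivOnAt f d x ∧ |d| ≤ C) (x y : U) :
    |f x - f y| ≤ C * |(x : ℝ) - y| := by
  choose d hd hC using h
  have := hU.norm_image_sub_le_of_norm_hasDerivWithin_le
    (f := Function.extend Subtype.val f 0) (f' := Function.extend Subtype.val d 0) (C := C)
    (fun z hz => by rw [extend_subtype_val_apply d ⟨z, hz⟩]; exact hd ⟨z, hz⟩)
    (fun z hz => by rw [extend_subtype_val_apply d ⟨z, hz⟩]; exact hC ⟨z, hz⟩) y.2 x.2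
  rwa [extend_subtype_val_apply, extend_subtype_val_apply] at this

theorem exists_lipschitzWith_of_hasDerivOnAt (hU : Convex ℝ U) {C : ℝ}
    (h : ∀ x, ∃ d, HasDerivOnAt f d x ∧ |d| ≤ C) : ∃ k : ℝ≥0, LipschitzWith k f :=
  ⟨C.toNNReal, .of_dist_le' (abs_sub_le_of_hasDerivOnAt hU h)⟩

end HasDerivOnAt

namespace LipSpace

variable {U : Set ℝ} {f g : LipSpace U}

/-- A Lipschitz function as an element of `Lip(U)`. -/
def mk (f : U → ℝ) (hf : ∃ k : ℝ≥0, LipschitzWith k f) : LipSpace U :=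
  (⟨f, hf⟩ : lipSubmodule U)

theorem ext (h : ∀ x, f x = g x) : f = g :=
  Subtype.ext (funext h)

theorem norm_le_of_hasDerivOnAt (hU : Convex ℝ U) {C : ℝ} (hC : 0 ≤ C)
    (h : ∀ x, ∃ d, HasDerivOnAt f.toFun d x ∧ |d| ≤ C) : ‖f‖ ≤ C :=
  Real.iSup_le (fun p => div_le_of_le_mul₀ (abs_nonneg _) hC
    (abs_sub_le_of_hasDerivOnAt hU h p.1 p.2)) hC

theorem abs_sub_le (f : LipSpace U) (x y : U) : |f x - f y| ≤ ‖f‖ * |(x : ℝ) - y| := by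
  rcases eq_or_ne x y with rfl | h
  · simp
  · have h' : 0 < |(x : ℝ) - y| := abs_pos.2 (sub_ne_zero.2 (Subtype.coe_ne_coe.2 h))
    rw [← div_le_iff₀ h']
    exact le_ciSup f.bddAbove_quotients (x, y)

theorem abs_deriv_le_norm (hU : IsOpen U) {d : ℝ} {x : U} (h : HasDerivOnAt f.toFun d x) :
    |d| ≤ ‖f‖ := by
  refine (h.hasDerivAt hU).le_of_lip' (norm_nonneg f) ?_
  filter_upwards [hU.mem_nhds x.2] with y hy
  rw [extend_subtype_val_apply _ ⟨y, hy⟩, extend_subtype_val_apply]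
  exact f.abs_sub_le ⟨y, hy⟩ x

end LipSpace

section ClarkeSubdiff

variable {U : Set ℝ} {f g : U → ℝ} {x : U}

theorem clarkeSubdiff_eq_convexHull_closure (f : U → ℝ) (x : U) :
    clarkeSubdiff f x =
      convexHull ℝ {p : ℝ | (x, p) ∈ closure {q : U × ℝ | HasDerivOnAt f q.2 q.1}} := by
  rw [clarkeSubdiff]
  congr 1
  ext p
  rw [Set.mem_ofPred_eq, Set.mem_ofPred_eq, mem_closure_iff_seq_limit]
  constructor
  · rintro ⟨u, d, h, hu, hd⟩
    exact ⟨fun n => (u n, d n), h, hu.prodMk_nhds hd⟩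
  · rintro ⟨s, hs, hl⟩
    exact ⟨fun n => (s n).1, fun n => (s n).2, hs, (Prod.tendsto_iff _ _).1 hl⟩

theorem clarkeSubdiff_eq_convexHull_clusterSet (hU : IsOpen U) {h : ℝ → ℝ}
    (hf : ∀ t : U, HasDerivOnAt f (h t) t) (x : U) :
    clarkeSubdiff f x = convexHull ℝ (clusterSet h x) := by
  have hgraph : {q : U × ℝ | HasDerivOnAt f q.2 q.1} = {q : U × ℝ | h q.1 = q.2} := by
    ext q
    rw [Set.mem_ofPred_eq, Set.mem_ofPred_eq]
    exact ⟨(hf q.1).unique hU, fun hq => hq ▸ hf q.1⟩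
  rw [clarkeSubdiff_eq_convexHull_closure, hgraph, ← clusterSet_comp_subtypeVal hU]
  congr 1
  ext p
  rw [Set.mem_ofPred_eq, mem_clusterSet_iff_mem_closure]
  rfl

theorem clarkeSubdiff_congr (h : f =ᶠ[𝓝 x] g) : clarkeSubdiff f x = clarkeSubdiff g x := by
  rw [clarkeSubdiff_eq_convexHull_closure, clarkeSubdiff_eq_convexHull_closure]
  congr 1
  ext p
  rw [Set.mem_ofPred_eq, Set.mem_ofPred_eq, mem_closure_iff_frequently, mem_closure_iff_frequently]
  refine Filter.frequently_congr ?_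
  filter_upwards [(continuous_fst.tendsto (x, p)).eventually h.eventuallyEq_nhds] with q hq
  exact hasDerivOnAt_congr hq

theorem clarkeSubdiff_add_const (f : U → ℝ) (c : ℝ) (x : U) :
    clarkeSubdiff (fun t => f t + c) x = clarkeSubdiff f x := by
  simp only [clarkeSubdiff, hasDerivOnAt_add_const_iff]

open scoped Pointwise in
theorem clarkeSubdiff_const_mul (f : U → ℝ) {c : ℝ} (hc : c ≠ 0) (x : U) :
    clarkeSubdiff (fun t => c * f t) x = c • clarkeSubdiff f x := by
  rw [clarkeSubdiff, clarkeSubdiff, ← convexHull_smul]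
  congr 1
  ext p
  rw [Set.mem_smul_set_iff_inv_smul_mem₀ hc]
  constructor
  · rintro ⟨u, d, h, hu, hd⟩
    refine ⟨u, fun n => c⁻¹ * d n, fun n => ?_, hu, hd.const_mul _⟩
    simpa only [inv_mul_cancel_left₀ hc] using (h n).const_mul c⁻¹
  · rintro ⟨u, d, h, hu, hd⟩
    refine ⟨u, fun n => c * d n, fun n => (h n).const_mul c, hu, ?_⟩
    simpa only [smul_eq_mul, mul_inv_cancel_left₀ hc] using hd.const_mul c

theorem clarkeSubdiff_eq_singleton_zero (hU : IsOpen U) (h : ∀ᶠ t in 𝓝 x, f t = 0) :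
    clarkeSubdiff f x = {0} := by
  rw [clarkeSubdiff_congr (g := fun _ => 0) h,
    clarkeSubdiff_eq_convexHull_clusterSet hU (h := fun _ => 0) hasDerivOnAt_zero,
    clusterSet_const, convexHull_singleton]

theorem LipSpace.clarkeSubdiff_subset_closedBall (hU : IsOpen U) (f : LipSpace U) (x : U) :
    clarkeSubdiff f.toFun x ⊆ Metric.closedBall 0 ‖f‖ := by
  refine convexHull_min ?_ (convex_closedBall 0 _)
  rintro p ⟨u, d, hd, -, hp⟩
  exact Metric.isClosed_closedBall.mem_of_tendsto hp
    (.of_forall fun n => mem_closedBall_zero_iff.2 (abs_deriv_le_norm hU (hd n)))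

end ClarkeSubdiff

theorem exists_mem_exhaustiveSet {U : Set ℝ} (hU : IsOpen U) (hUc : Convex ℝ U) {α β : ℝ}
    (hαβ : α < β) (hαU : α ∈ U) (hβU : β ∈ U) : ∃ f ∈ exhaustiveSet U, ‖f‖ = 1 ∧
      tsupport f.toFun ⊆ {t | (t : ℝ) ∈ Set.Ioo α β} := by
  obtain ⟨H, hH, hH1, hsupp, hK⟩ :=
    exists_differentiable_tsupport_subset_clusterExhaustiveOn hαβ
  have hsub : Set.Ioo α β ⊆ U := Set.Ioo_subset_Icc_self.trans (hUc.ordConnected.out hαU hβU)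
  have hd : ∀ t : U, HasDerivOnAt (fun t : U => H t) (deriv H t) t := fun t =>
    (hasDerivOnAt_iff_hasDerivAt hU fun _ => rfl).2 (hH t).hasDerivAt
  have hd1 : ∀ t : U, ∃ d, HasDerivOnAt (fun t : U => H t) d t ∧ |d| ≤ 1 := fun t =>
    ⟨_, hd t, hH1 t⟩
  let f : LipSpace U := .mk (fun t => H t) (exists_lipschitzWith_of_hasDerivOnAt hUc hd1)
  have hf : ∀ t : U, HasDerivOnAt f.toFun (deriv H t) t := hd
  have hfK : ∀ K : Set ℝ, K.Nonempty → IsClosed K → Convex ℝ K → K ⊆ Metric.closedBall 0 1 →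
      ∃ x, clarkeSubdiff f.toFun x = K := fun K hKne hKcl hKconv hK1 => by
    obtain ⟨x, hx, hxK⟩ := hK K hKne hKcl hKconv hK1
    exact ⟨⟨x, hsub hx⟩, by
      rw [clarkeSubdiff_eq_convexHull_clusterSet hU hf, hxK, hKconv.convexHull_eq]⟩
  have hnorm : ‖f‖ = 1 := by
    refine (LipSpace.norm_le_of_hasDerivOnAt (f := f) hUc zero_le_one hd1).antisymm ?_
    obtain ⟨x, hx⟩ := hfK {1} (Set.singleton_nonempty 1) isClosed_singleton (convex_singleton 1)
      (by simp)
    simpa [hx] using f.clarkeSubdiff_subset_closedBall hU x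
  refine ⟨f, ⟨fun x => ⟨_, hf x⟩, fun K => ?_⟩, hnorm, ?_⟩
  · rw [hnorm]
    exact hfK K
  · exact (tsupport_comp_subset_preimage H continuous_subtype_val).trans
      (Set.preimage_mono hsupp)

theorem isOpen_openInterval (a b : EReal) : IsOpen (openInterval a b) :=
  (isOpen_Ioi.preimage continuous_coe_real_ereal).inter
    (isOpen_Iio.preimage continuous_coe_real_ereal)

theorem convex_openInterval (a b : EReal) : Convex ℝ (openInterval a b) := by
  refine Set.OrdConnected.convex ⟨fun x hx y hy z hz => ⟨?_, ?_⟩⟩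
  · exact hx.1.trans_le (EReal.coe_le_coe_iff.2 hz.1)
  · exact (EReal.coe_le_coe_iff.2 hz.2).trans_lt hy.2

theorem exists_isDisjointExhaustiveSeq {a b : EReal} (hab : a < b) :
    ∃ (α β : ℕ → ℝ) (f : ℕ → LipSpace (openInterval a b)), IsDisjointExhaustiveSeq a b α β f := by
  obtain ⟨q, haq, hqb⟩ := EReal.lt_iff_exists_real_btwn.1 hab
  obtain ⟨p, hap, hpq⟩ := EReal.lt_iff_exists_real_btwn.1 haq
  obtain ⟨u, hu, hupq, -⟩ := exists_seq_strictMono_tendsto' (EReal.coe_lt_coe_iff.1 hpq)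
  have hmem : ∀ n, u n ∈ openInterval a b := fun n =>
    ⟨hap.trans (EReal.coe_lt_coe_iff.2 (hupq n).1), (EReal.coe_lt_coe_iff.2 (hupq n).2).trans hqb⟩
  choose f hf hf1 hfs using fun n : ℕ => exists_mem_exhaustiveSet (isOpen_openInterval a b)
    (convex_openInterval a b) (hu (Nat.lt_succ_self (2 * n))) (hmem _) (hmem _)
  exact ⟨fun n => u (2 * n), fun n => u (2 * n + 1), f, fun n => (hmem _).1,
    fun n => hu (Nat.lt_succ_self _), fun n => hu (Nat.lt_succ_self _), fun n => (hmem _).2, hf,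
    hf1, hfs⟩

theorem hasSum_mul_of_forall_ne {ι R : Type*} [NonUnitalNonAssocSemiring R] [TopologicalSpace R]
    (x : ι → R) {y : ι → R} {n : ι} (hy : ∀ m ≠ n, y m = 0) :
    HasSum (fun m => x m * y m) (x n * y n) :=
  hasSum_single n fun m hm => by rw [hy m hm, mul_zero]

theorem exists_norm_apply_eq_norm_zeroAtInfty {X E : Type*} [TopologicalSpace X] [Nonempty X]
    [NormedAddCommGroup E] (x : C₀(X, E)) : ∃ a, ‖x a‖ = ‖x‖ := by
  obtain ⟨a, ha⟩ : ∃ a, ∀ b, ‖x b‖ ≤ ‖x a‖ := by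
    rcases eq_or_ne x 0 with rfl | hx
    · exact ⟨Classical.arbitrary X, fun b => le_rfl⟩
    · obtain ⟨k, hk⟩ := DFunLike.ne_iff.1 hx
      refine (map_continuous x).norm.exists_forall_ge' k ?_
      exact ((zero_at_infty x).norm.eventually_lt_const (by simpa using hk)).mono fun _ => le_of_lt
  refine ⟨a, (x.toBCF.norm_coe_le_norm a).antisymm ?_⟩
  exact (BoundedContinuousFunction.norm_le (norm_nonneg _)).2 ha

namespace IsDisjointExhaustiveSeq

variable {a b : EReal} {α β : ℕ → ℝ} {f : ℕ → LipSpace (openInterval a b)}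

theorem strictMono_left (hs : IsDisjointExhaustiveSeq a b α β f) : StrictMono α :=
  strictMono_nat_of_lt_succ fun n => (hs.lt n).trans (hs.lt_succ n)

theorem right_lt_left (hs : IsDisjointExhaustiveSeq a b α β f) {m n : ℕ} (h : m < n) :
    β m < α n :=
  (hs.lt_succ m).trans_le (hs.strictMono_left.monotone h)

theorem right_mem (hs : IsDisjointExhaustiveSeq a b α β f) (n : ℕ) : β n ∈ openInterval a b :=
  ⟨(hs.left_lt n).trans (EReal.coe_lt_coe_iff.2 (hs.lt n)), hs.lt_right n⟩

theorem eventually_apply_eq_zero (hs : IsDisjointExhaustiveSeq a b α β f) {n : ℕ}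
    {t : openInterval a b} (ht : (t : ℝ) ∉ Set.Ioo (α n) (β n)) : ∀ᶠ s in 𝓝 t, f n s = 0 :=
  notMem_tsupport_iff_eventuallyEq.1 fun h => ht (hs.supp n h)

theorem apply_eq_zero (hs : IsDisjointExhaustiveSeq a b α β f) {n : ℕ} {t : openInterval a b}
    (ht : (t : ℝ) ∉ Set.Ioo (α n) (β n)) : f n t = 0 :=
  (hs.eventually_apply_eq_zero ht).self_of_nhds

theorem apply_eq_zero_of_ne (hs : IsDisjointExhaustiveSeq a b α β f) {m n : ℕ} (hmn : m ≠ n)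
    {t : openInterval a b} (ht : (t : ℝ) ∈ Set.Ioo (α n) (α (n + 1))) : f m t = 0 := by
  refine hs.apply_eq_zero fun h => ?_
  rcases hmn.lt_or_gt with hlt | hgt
  · exact lt_asymm (h.2.trans (hs.right_lt_left hlt)) ht.1
  · exact (h.1.trans ht.2).not_ge (hs.strictMono_left.monotone hgt)

theorem exists_forall_ne_apply_eq_zero (hs : IsDisjointExhaustiveSeq a b α β f)
    (t : openInterval a b) : ∃ n, ∀ m ≠ n, f m t = 0 := by
  by_cases h : ∃ n, (t : ℝ) ∈ Set.Ioo (α n) (β n)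
  · obtain ⟨n, hn⟩ := h
    exact ⟨n, fun m hm => hs.apply_eq_zero_of_ne hm ⟨hn.1, hn.2.trans (hs.lt_succ n)⟩⟩
  · exact ⟨0, fun m _ => hs.apply_eq_zero (not_exists.1 h m)⟩

theorem summable (hs : IsDisjointExhaustiveSeq a b α β f) (x : ℕ → ℝ) (t : openInterval a b) :
    Summable fun m => x m * f m t := by
  obtain ⟨n, hn⟩ := hs.exists_forall_ne_apply_eq_zero t
  exact (hasSum_mul_of_forall_ne x hn).summable

theorem tsum_eventuallyEq_of_mem (hs : IsDisjointExhaustiveSeq a b α β f) (x : ℕ → ℝ) {n : ℕ}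
    {t : openInterval a b} (ht : (t : ℝ) ∈ Set.Ioo (α n) (α (n + 1))) :
    (fun s => ∑' m, x m * f m s) =ᶠ[𝓝 t] fun s => x n * f n s := by
  filter_upwards [continuous_subtype_val.continuousAt (Ioo_mem_nhds ht.1 ht.2)] with s hs'
  exact (hasSum_mul_of_forall_ne x fun m hm => hs.apply_eq_zero_of_ne hm hs').tsum_eq

theorem abs_deriv_le_one (hs : IsDisjointExhaustiveSeq a b α β f) {n : ℕ} {d : ℝ}
    {t : openInterval a b} (hd : HasDerivOnAt (f n).toFun d t) : |d| ≤ 1 :=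
  hs.norm_eq n ▸ LipSpace.abs_deriv_le_norm (isOpen_openInterval a b) hd

theorem hasDerivOnAt_tsum_zero (hs : IsDisjointExhaustiveSeq a b α β f) {x : ℕ → ℝ}
    (hx : Filter.Tendsto x Filter.atTop (𝓝 0)) {t : openInterval a b}
    (ht : ∀ n, (t : ℝ) ∉ Set.Ioo (α n) (β n)) :
    HasDerivOnAt (fun s : openInterval a b => ∑' m, x m * f m s) 0 t := by
  have ht0 : ∀ n, f n t = 0 := fun n => hs.apply_eq_zero (ht n)
  rw [hasDerivOnAt_iff_isLittleO, Asymptotics.isLittleO_iff]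
  intro ε hε
  obtain ⟨N, hN⟩ := Filter.eventually_atTop.1 (hx.norm.eventually_lt_const (by simpa using hε))
  filter_upwards [(Filter.eventually_all_finset (Finset.range N)).2
    fun n _ => hs.eventually_apply_eq_zero (ht n)] with s hs0
  obtain ⟨n, hn⟩ := hs.exists_forall_ne_apply_eq_zero s
  simp only [(hasSum_mul_of_forall_ne x hn).tsum_eq, ht0, mul_zero, tsum_zero, sub_zero, norm_mul]
  rcases lt_or_ge n N with hnN | hNn
  · rw [hs0 n (Finset.mem_range.2 hnN), norm_zero, mul_zero]
    positivity
  · have hlip := (f n).abs_sub_le s t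
    rw [ht0 n, hs.norm_eq, sub_zero, one_mul] at hlip
    exact mul_le_mul (hN n hNn).le hlip (norm_nonneg _) hε.le

theorem exists_hasDerivOnAt_tsum (hs : IsDisjointExhaustiveSeq a b α β f) {x : ℕ → ℝ}
    (hx : Filter.Tendsto x Filter.atTop (𝓝 0)) {C : ℝ} (hC : ∀ n, |x n| ≤ C)
    (t : openInterval a b) :
    ∃ d, HasDerivOnAt (fun s : openInterval a b => ∑' m, x m * f m s) d t ∧ |d| ≤ C := by
  by_cases h : ∃ n, (t : ℝ) ∈ Set.Ioo (α n) (β n)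
  · obtain ⟨n, hn⟩ := h
    obtain ⟨d, hd⟩ := (hs.mem n).1 t
    refine ⟨x n * d, (hasDerivOnAt_congr (hs.tsum_eventuallyEq_of_mem x
      ⟨hn.1, hn.2.trans (hs.lt_succ n)⟩)).2 (hd.const_mul _), ?_⟩
    rw [abs_mul]
    exact (mul_le_of_le_one_right (abs_nonneg _) (hs.abs_deriv_le_one hd)).trans (hC n)
  · refine ⟨0, hs.hasDerivOnAt_tsum_zero hx (not_exists.1 h), ?_⟩
    rw [abs_zero]
    exact (abs_nonneg _).trans (hC 0)

theorem clarkeSubdiff_tsum_right (hs : IsDisjointExhaustiveSeq a b α β f) (x : ℕ → ℝ) (n : ℕ) :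
    clarkeSubdiff (fun s : openInterval a b => ∑' m, x m * f m s) ⟨β n, hs.right_mem n⟩ = {0} := by
  refine clarkeSubdiff_eq_singleton_zero (isOpen_openInterval a b) ?_
  filter_upwards [hs.tsum_eventuallyEq_of_mem x (t := ⟨β n, hs.right_mem n⟩)
    ⟨hs.lt n, hs.lt_succ n⟩, hs.eventually_apply_eq_zero (t := ⟨β n, hs.right_mem n⟩) (n := n)
    fun h => h.2.false] with s hsum hs0
  rw [hsum, hs0, mul_zero]

open scoped Pointwise in
theorem exists_clarkeSubdiff_tsum_eq (hs : IsDisjointExhaustiveSeq a b α β f) (x : ℕ → ℝ) {n : ℕ}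
    {K : Set ℝ} (hKne : K.Nonempty) (hKcl : IsClosed K) (hKconv : Convex ℝ K)
    (hKx : K ⊆ Metric.closedBall 0 |x n|) :
    ∃ t, clarkeSubdiff (fun s : openInterval a b => ∑' m, x m * f m s) t = K := by
  by_cases hK0 : K = {0}
  · exact ⟨_, hK0 ▸ hs.clarkeSubdiff_tsum_right x n⟩
  have hxn : x n ≠ 0 := fun h => hK0 <| hKne.subset_singleton_iff.1 <| by
    rwa [h, abs_zero, Metric.closedBall_zero] at hKx
  have hscale : (x n)⁻¹ • K ⊆ Metric.closedBall 0 ‖f n‖ := by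
    refine (Set.smul_set_mono hKx).trans ?_
    rw [hs.norm_eq, smul_closedBall' (inv_ne_zero hxn), smul_zero, norm_inv, Real.norm_eq_abs,
      inv_mul_cancel₀ (abs_ne_zero.2 hxn)]
  obtain ⟨t, ht⟩ := (hs.mem n).2 _ hKne.smul_set (hKcl.smul_of_ne_zero (inv_ne_zero hxn))
    (hKconv.smul _) hscale
  have htn : (t : ℝ) ∈ Set.Ioo (α n) (β n) := by
    by_contra h
    rw [clarkeSubdiff_eq_singleton_zero (isOpen_openInterval a b)
      (hs.eventually_apply_eq_zero h)] at ht
    exact hK0 (by rw [← smul_inv_smul₀ hxn K, ← ht, Set.smul_set_singleton, smul_zero])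
  refine ⟨t, ?_⟩
  rw [clarkeSubdiff_congr (hs.tsum_eventuallyEq_of_mem x ⟨htn.1, htn.2.trans (hs.lt_succ n)⟩),
    clarkeSubdiff_const_mul _ hxn, ht, smul_inv_smul₀ hxn]

theorem exists_hasDerivOnAt_tsum_zeroAtInfty (hs : IsDisjointExhaustiveSeq a b α β f)
    (x : C₀(ℕ, ℝ)) (t : openInterval a b) :
    ∃ d, HasDerivOnAt (fun s : openInterval a b => ∑' m, x m * f m s) d t ∧ |d| ≤ ‖x‖ :=
  hs.exists_hasDerivOnAt_tsum (x := x)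
    (by simpa only [Filter.cocompact_eq_cofinite, Nat.cofinite_eq_atTop] using zero_at_infty x)
    x.toBCF.norm_coe_le_norm t

/-- The function `∑ n, x n * f n` as an element of `Lip(I)`. -/
noncomputable def sumLip (hs : IsDisjointExhaustiveSeq a b α β f) (x : C₀(ℕ, ℝ)) :
    LipSpace (openInterval a b) :=
  .mk (fun t => ∑' m, x m * f m t) (exists_lipschitzWith_of_hasDerivOnAt
    (convex_openInterval a b) (hs.exists_hasDerivOnAt_tsum_zeroAtInfty x))

theorem hasSum_sumLip (hs : IsDisjointExhaustiveSeq a b α β f) (x : C₀(ℕ, ℝ))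
    (t : openInterval a b) : HasSum (fun n => x n * f n t) (hs.sumLip x t) :=
  (hs.summable x t).hasSum

theorem norm_sumLip (hs : IsDisjointExhaustiveSeq a b α β f) (x : C₀(ℕ, ℝ)) :
    ‖hs.sumLip x‖ = ‖x‖ := by
  refine (LipSpace.norm_le_of_hasDerivOnAt (f := hs.sumLip x) (convex_openInterval a b)
    (norm_nonneg x) (hs.exists_hasDerivOnAt_tsum_zeroAtInfty x)).antisymm ?_
  obtain ⟨n, hn⟩ := exists_norm_apply_eq_norm_zeroAtInfty x
  obtain ⟨t, ht⟩ := hs.exists_clarkeSubdiff_tsum_eq x (n := n) (Set.singleton_nonempty (x n))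
    isClosed_singleton (convex_singleton _) (by simp)
  have hsub := (hs.sumLip x).clarkeSubdiff_subset_closedBall (isOpen_openInterval a b) t
  rw [← hn]
  exact mem_closedBall_zero_iff.1 (hsub (ht.ge rfl))

theorem sumLip_mem_exhaustiveSet (hs : IsDisjointExhaustiveSeq a b α β f) (x : C₀(ℕ, ℝ)) :
    hs.sumLip x ∈ exhaustiveSet (openInterval a b) := by
  refine ⟨fun t => (hs.exists_hasDerivOnAt_tsum_zeroAtInfty x t).imp fun _ => And.left,
    fun K hKne hKcl hKconv hKx => ?_⟩
  obtain ⟨n, hn⟩ := exists_norm_apply_eq_norm_zeroAtInfty x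
  rw [hs.norm_sumLip, ← hn] at hKx
  exact hs.exists_clarkeSubdiff_tsum_eq x hKne hKcl hKconv hKx

/-- The linear isometry `x ↦ ∑ n, x n * f n` from `c₀` to `Lip(I)`. -/
noncomputable def sumLipₗᵢ (hs : IsDisjointExhaustiveSeq a b α β f) :
    C₀(ℕ, ℝ) →ₗᵢ[ℝ] LipSpace (openInterval a b) where
  toFun := hs.sumLip
  map_add' x y := LipSpace.ext fun t => (hs.hasSum_sumLip (x + y) t).unique <| by
    simpa [LipSpace.add_apply, add_mul] using (hs.hasSum_sumLip x t).add (hs.hasSum_sumLip y t)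
  map_smul' c x := LipSpace.ext fun t => (hs.hasSum_sumLip (c • x) t).unique <| by
    simpa [LipSpace.smul_apply, mul_assoc] using (hs.hasSum_sumLip x t).mul_left c
  norm_map' := hs.norm_sumLip

end IsDisjointExhaustiveSeq

theorem not_finiteDimensional_zeroAtInfty {X : Type*} [TopologicalSpace X] [DiscreteTopology X]
    [Infinite X] : ¬FiniteDimensional ℝ C₀(X, ℝ) := fun _ => by
  classical
  let coeFn : C₀(X, ℝ) →ₗ[ℝ] X → ℝ :=
    { toFun := (⇑), map_add' := fun _ _ => rfl, map_smul' := fun _ _ => rfl }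
  let single (i : X) : C₀(X, ℝ) :=
    { toFun := Pi.single i 1
      continuous_toFun := continuous_of_discreteTopology
      zero_at_infty' := tendsto_const_nhds.congr' <| by
        rw [Filter.cocompact_eq_cofinite]
        filter_upwards [(Set.finite_singleton i).compl_mem_cofinite] with j hj
        exact (Pi.single_eq_of_ne (M := fun _ => ℝ) hj 1).symm }
  have hli : LinearIndependent ℝ (coeFn ∘ single) := Pi.linearIndependent_single_one X ℝ
  exact not_finite_iff_infinite.2 ‹Infinite X› (LinearIndependent.of_comp coeFn hli).finite

theorem mem_exhaustiveSet_of_inseparable {U : Set ℝ} {f g : LipSpace U} (hfg : Inseparable f g)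
    (hf : f ∈ exhaustiveSet U) : g ∈ exhaustiveSet U := by
  rcases isEmpty_or_nonempty U with hU | ⟨⟨x₀⟩⟩
  · rwa [LipSpace.ext (f := g) (g := f) fun x => hU.elim x]
  have hdist : ‖g - f‖ = 0 := by
    rw [← dist_eq_norm, dist_comm, Metric.inseparable_iff.1 hfg]
  have hg : g.toFun = fun t => f t + (g x₀ - f x₀) := by
    funext t
    have hle : |(g t - f t) - (g x₀ - f x₀)| ≤ ‖g - f‖ * |(t : ℝ) - x₀| := (g - f).abs_sub_le t x₀
    rw [hdist, zero_mul] at hle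
    linarith [abs_nonpos_iff.1 hle]
  refine ⟨fun x => (hf.1 x).imp fun d hd => ?_, fun K hKne hKcl hKconv hKg => ?_⟩
  · rwa [hg, hasDerivOnAt_add_const_iff]
  · rw [← hfg.norm_eq_norm] at hKg
    obtain ⟨x, hx⟩ := hf.2 K hKne hKcl hKconv hKg
    exact ⟨x, by rw [hg, clarkeSubdiff_add_const, hx]⟩

theorem isSpaceable_of_linearIsometry {E X : Type*} [NormedAddCommGroup E] [NormedSpace ℝ E]
    [CompleteSpace E] [SeminormedAddCommGroup X] [NormedSpace ℝ X] (hE : ¬FiniteDimensional ℝ E)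
    (T : E →ₗᵢ[ℝ] X) {A : Set X} (hTA : ∀ x, T x ∈ A)
    (hA : ∀ y z, Inseparable y z → y ∈ A → z ∈ A) : IsSpaceable A := by
  let R := LinearMap.range T.toLinearMap
  refine ⟨R.topologicalClosure, R.isClosed_topologicalClosure, fun _ => hE ?_, fun y hy => ?_⟩
  · exact .of_injective (T.toLinearMap.codRestrict _ fun x => R.le_topologicalClosure ⟨x, rfl⟩)
      fun x y hxy => T.injective (congrArg Subtype.val hxy)
  · obtain ⟨_, ⟨x, rfl⟩, hyx⟩ :=
      exists_inseparable_of_mem_closure T.isometry.isUniformInducing.isComplete_range hy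
    exact hA _ _ hyx.symm (hTA x)

theorem mainTheorem8 (a b : EReal) (hab : a < b) :
    IsSpaceable (exhaustiveSet (openInterval a b)) ∧
    (∃ (α β : ℕ → ℝ) (f : ℕ → LipSpace (openInterval a b)),
      IsDisjointExhaustiveSeq a b α β f) ∧
    (∀ (α β : ℕ → ℝ) (f : ℕ → LipSpace (openInterval a b)),
      IsDisjointExhaustiveSeq a b α β f →
        ∃ T : C₀(ℕ, ℝ) →ₗᵢ[ℝ] LipSpace (openInterval a b),
          (∀ (x : C₀(ℕ, ℝ)) (t : openInterval a b),
            HasSum (fun n => x n * f n t) (T x t)) ∧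
          ∀ x : C₀(ℕ, ℝ), T x ∈ exhaustiveSet (openInterval a b)) := by
  obtain ⟨α, β, f, hs⟩ := exists_isDisjointExhaustiveSeq hab
  exact ⟨isSpaceable_of_linearIsometry not_finiteDimensional_zeroAtInfty hs.sumLipₗᵢ
      hs.sumLip_mem_exhaustiveSet fun _ _ => mem_exhaustiveSet_of_inseparable,
    ⟨α, β, f, hs⟩, fun _ _ _ hs =>
      ⟨hs.sumLipₗᵢ, hs.hasSum_sumLip, hs.sumLip_mem_exhaustiveSet⟩⟩
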